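/- Setting. Let $E\subseteq\mathbb R^d$ be measurable and let $\chi(y)=y$ for $|y|\le 1$, $\chi(y)=y/|y|$ for $|y|>1$, where $|\cdot|$ is the Euclidean norm. A function $q:E\times\mathbb R^d\to\mathbb C$ is a *symbol* if $$q(x,u)=i\langle u,b(x)\rangle-\tfrac12\langle c(x)u,u\rangle+\int_{\mathbb R^d}\bigl(e^{i\langle u,y\rangle}-1-i\langle u,\chi(y)\rangle\bigr)\,F(x,dy)$$ for some measurable $b:E\to\mathbb R^d$, some measurable $c$ on $E$ with values in the positive semidefinite $d\times d$ matrices, and some transition kernel $F$ from $E$ to $\mathbb R^d$ with $\int|\chi(y)|^2F(x,dy)<\infty$ for all $x\in E$. Let $X$ be a *Lévy-type process* with state space $E$ and symbol $q$: a strong Markov process with càdlàg paths in $E$ on $(\Omega,\mathcal A,(\mathcal F_t)_{t\ge0},(P_x)_{x\in E})$, with $P_x(X(0)=x)=1$, such that $q$ is a symbol and, for all $x\in E$, $u\in\mathbb R^d$ and $t\ge0$, $E_x\int_0^t|q(X(s),u)|\,ds<\infty$ and $M_u(t)=e^{i\langle u,X(t)\rangle}-\int_0^te^{i\langle u,X(s)\rangle}q(X(s),u)\,ds$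 is a martingale under $P_x$. For $R>0$ put $H(R)=\sup_{y\in E}\sup_{|\eta|\le1}|q(y,\eta/R)|\in[0,\infty]$, and let $$\beta_\infty=\inf\Bigl\{\lambda>0:\ \limsup_{R\downarrow0}R^\lambda H(R)=0\Bigr\}\qquad(\inf\emptyset=\infty)$$ be the uniform index. Proposition. Let $\lambda>\beta_\infty$ be a real number, let $\tau$ be an $(\mathcal F_t)$-stopping time with values in $[0,\infty]$, and let $x\in E$. Then there is a $P_x$-null set $N$ such that for every $\varepsilon>0$ there is a random variable $\delta:\Omega\to(0,\infty)$ with $$|X(\tau(\omega)+t)(\omega)-X(\tau(\omega))(\omega)|\le\varepsilon\,t^{1/\lambda}\qquad\text{for all }\omega\in\{\tau<\infty\}\setminus N\text{ and all }t\in[0,\delta(\omega)].$$ -/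

import Mathlib

open MeasureTheory ProbabilityTheory Filter Topology
open scoped NNReal ENNReal Matrix

noncomputable section

namespace LevyType

/-- The Euclidean space `ℝ^d`. -/
abbrev Rd (d : ℕ) := EuclideanSpace ℝ (Fin d)

/-- The truncation function: the identity on the closed unit ball and `y / |y|` outside it. -/
def trunc {d : ℕ} (y : Rd d) : Rd d := if ‖y‖ ≤ 1 then y else ‖y‖⁻¹ • y

/-- Markov triplets `(b, c, F)` on `E`: measurable drift `b`, measurable diffusion coefficient `c`
with values in the positive semidefinite matrices, and a transition kernel `F` from `E` to `ℝ^d`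
that integrates `|χ|²`. -/
structure IsMarkovTriplet {d : ℕ} {E : Set (Rd d)} (b : E → Rd d)
    (c : E → Matrix (Fin d) (Fin d) ℝ) (F : Kernel E (Rd d)) : Prop where
  measurable_drift : Measurable b
  measurable_diffusion : ∀ i j, Measurable fun x => c x i j
  posSemidef : ∀ x, (c x).PosSemidef
  lintegral_trunc_lt_top : ∀ x, ∫⁻ y, ‖trunc y‖ₑ ^ 2 ∂(F x) < ∞

/-- The function `q(x, u) = i⟨u, b(x)⟩ - ⟨c(x)u, u⟩ / 2
  + ∫ (exp(i⟨u, y⟩) - 1 - i⟨u, χ(y)⟩) F(x, dy)` of a triplet. -/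
def tripletSymbol {d : ℕ} {E : Set (Rd d)} (b : E → Rd d)
    (c : E → Matrix (Fin d) (Fin d) ℝ) (F : Kernel E (Rd d)) (x : E) (u : Rd d) : ℂ :=
  Complex.I * ((inner ℝ u (b x) : ℝ) : ℂ)
    - (1 / 2 : ℂ) * (((c x *ᵥ WithLp.ofLp u) ⬝ᵥ WithLp.ofLp u : ℝ) : ℂ)
    + ∫ y, (Complex.exp (Complex.I * ((inner ℝ u y : ℝ) : ℂ)) - 1
        - Complex.I * ((inner ℝ u (trunc y) : ℝ) : ℂ)) ∂(F x)

/-- A symbol is a function `q : E × ℝ^d → ℂ` that comes from some Markov triplet on `E`. -/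
def IsSymbol {d : ℕ} {E : Set (Rd d)} (q : E → Rd d → ℂ) : Prop :=
  ∃ (b : E → Rd d) (c : E → Matrix (Fin d) (Fin d) ℝ) (F : Kernel E (Rd d)),
    IsMarkovTriplet b c F ∧ ∀ x u, q x u = tripletSymbol b c F x u

/-- All paths are right continuous with left limits (in `ℝ^d`). -/
def IsCadlagProcess {d : ℕ} {E : Set (Rd d)} {Ω : Type*} (X : ℝ≥0 → Ω → E) : Prop :=
  ∀ ω t, ContinuousWithinAt (fun s => X s ω) (Set.Ici t) t ∧
    ∃ l : Rd d, Tendsto (fun s => (X s ω : Rd d)) (𝓝[<] t) (𝓝 l)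

/-- The process `M_u(t) = exp(i⟨u, X(t)⟩) - ∫₀ᵗ exp(i⟨u, X(s)⟩) q(X(s), u) ds`. -/
def symbolProcess {d : ℕ} {E : Set (Rd d)} {Ω : Type*} (X : ℝ≥0 → Ω → E)
    (q : E → Rd d → ℂ) (u : Rd d) (t : ℝ≥0) (ω : Ω) : ℂ :=
  Complex.exp (Complex.I * ((inner ℝ u (X t ω : Rd d) : ℝ) : ℂ))
    - ∫ s in (0 : ℝ)..(t : ℝ),
        Complex.exp (Complex.I * ((inner ℝ u (X s.toNNReal ω : Rd d) : ℝ) : ℂ))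
          * q (X s.toNNReal ω) u

/-- `q` is the symbol of the process `X` under the probability measure `μ`. -/
structure HasSymbol {d : ℕ} {E : Set (Rd d)} {Ω : Type*} {mΩ : MeasurableSpace Ω}
    (X : ℝ≥0 → Ω → E) (𝓕 : Filtration ℝ≥0 mΩ) (μ : Measure Ω) (q : E → Rd d → ℂ) : Prop where
  isSymbol : IsSymbol q
  lintegral_lt_top : ∀ (t : ℝ≥0) (u : Rd d),
    ∫⁻ ω, (∫⁻ s in Set.Icc (0 : ℝ) (t : ℝ), ‖q (X s.toNNReal ω) u‖ₑ) ∂μ < ∞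
  martingale : ∀ u : Rd d, Martingale (symbolProcess X q u) 𝓕 μ

/-- `X` is a strong Markov process on `(Ω, 𝓕, (P x)_{x ∈ E})` with `P x (X 0 = x) = 1`. Its
transition function is `(t, x, Γ) ↦ P x (X t ∈ Γ)`. In the strong Markov property the time `τ ω`
is replaced by `0` on the null set where `τ ω` is infinite. -/
structure IsStrongMarkovProcess {d : ℕ} {E : Set (Rd d)} {Ω : Type*} {mΩ : MeasurableSpace Ω}
    (X : ℝ≥0 → Ω → E) (𝓕 : Filtration ℝ≥0 mΩ) (P : E → Measure Ω) : Prop where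
  isProbabilityMeasure : ∀ x, IsProbabilityMeasure (P x)
  adapted : Adapted 𝓕 X
  initial : ∀ x, ∀ᵐ ω ∂(P x), X 0 ω = x
  measurable_transition : ∀ (t : ℝ≥0) (Γ : Set E), MeasurableSet Γ →
    Measurable fun x => P x {ω | X t ω ∈ Γ}
  strongMarkov : ∀ (x : E) (τ : Ω → WithTop ℝ≥0) (hτ : IsStoppingTime 𝓕 τ),
    (∀ᵐ ω ∂(P x), τ ω ≠ ⊤) → ∀ (t : ℝ≥0) (Γ : Set E), MeasurableSet Γ →
      (P x)⟦{ω | X ((τ ω).untopD 0 + t) ω ∈ Γ} | hτ.measurableSpace⟧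
        =ᵐ[P x] fun ω => (P (X ((τ ω).untopD 0) ω)).real {ω' | X t ω' ∈ Γ}

/-- `X` is a Lévy-type process with state space `E` and symbol `q`. -/
structure IsLevyTypeProcess {d : ℕ} {E : Set (Rd d)} {Ω : Type*} {mΩ : MeasurableSpace Ω}
    (X : ℝ≥0 → Ω → E) (𝓕 : Filtration ℝ≥0 mΩ) (P : E → Measure Ω) (q : E → Rd d → ℂ) :
    Prop where
  measurableSet_stateSpace : MeasurableSet E
  cadlag : IsCadlagProcess X
  strongMarkov : IsStrongMarkovProcess X 𝓕 P
  hasSymbol : ∀ x, HasSymbol X 𝓕 (P x) q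

/-- `H(R) = sup_{y ∈ E} sup_{|ε| ≤ 1} |q(y, ε / R)|` in `[0, ∞]`. (Extending `q` by zero to the
points outside `E` does not change the supremum.) -/
def symbolSup {d : ℕ} {E : Set (Rd d)} (q : E → Rd d → ℂ) (R : ℝ) : ℝ≥0∞ :=
  ⨆ (y : E) (ε : Rd d) (_ : ‖ε‖ ≤ 1), ‖q y (R⁻¹ • ε)‖ₑ

/-- The uniform index
`β_∞ = inf {l > 0 : limsup_{R ↓ 0} R^l H(R) = 0}`, with `inf ∅ = ∞`. -/
def uniformIndex {d : ℕ} {E : Set (Rd d)} (q : E → Rd d → ℂ) : ℝ≥0∞ :=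
  ⨅ (l : ℝ) (_ : 0 < l)
    (_ : limsup (fun R : ℝ => ENNReal.ofReal (R ^ l) * symbolSup q R) (𝓝[>] 0) = 0),
    ENNReal.ofReal l

end LevyType

end

/-! Since `1 / lam < 1 / l` for some `l` with `H(R) ≤ R ^ (-l)` near zero, there is room for an
exponent `b` strictly between. The martingale `M_u` shows that the characteristic function of `X_h -
y` under `P_y` differs from 1 by at most `h sup |q(·, u)|`, so the truncation inequality gives
`P_y(|X_h - y| > r) ≤ 2 d h H(r / (2(d + 1)))`, uniformly in `y` (`measure_norm_sub_gt_le`).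
Uniformity and the strong Markov property turn this into a maximal inequality after a finite
stopping time (`measure_exists_mem_finset_le`, `measure_largeIncrement_le`).

At times of order `2^{-m}` and levels `2^{-mb}` the probabilities are at most a constant times
`2^{-m(1 - bl)}`, hence summable (`tsum_measure_largeIncrement_ne_top`). By Borel–Cantelli the
increments are eventually of order `t ^ b`, and `b > 1 / lam` absorbs any `ε`. The exceptional
events do not involve `ε`, so one null set serves all `ε`. -/

namespace LevyType

/-! ### Measurability at stopping times. -/

section Progressive

variable {Ω β : Type*} {mΩ : MeasurableSpace Ω} {𝓕 : Filtration ℝ≥0 mΩ}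
  [TopologicalSpace β] [TopologicalSpace.PseudoMetrizableSpace β] [MeasurableSpace β]
  [BorelSpace β] [SecondCountableTopology β]

/-- A right continuous adapted process is progressively measurable. -/
theorem isStronglyProgressive_of_rightContinuous {u : ℝ≥0 → Ω → β} (hu : Adapted 𝓕 u)
    (hc : ∀ ω t, ContinuousWithinAt (fun s => u s ω) (Set.Ici t) t) :
    IsStronglyProgressive 𝓕 u := by
  intro i
  -- Grid points taken strictly to the right of `t`, so that right continuity applies, then capped
  -- at `i` to remain `𝓕 i`-measurable.
  let a : ℕ → ℕ → ℝ≥0 := fun n k => min i (((k : ℝ≥0) + 1) / ((n : ℝ≥0) + 1))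
  let U : ℕ → Set.Iic i × Ω → β := fun n p => u (a n ⌊((n : ℝ≥0) + 1) * p.1⌋₊) p.2
  have hU : ∀ n, StronglyMeasurable[Subtype.instMeasurableSpace.prod (𝓕 i)] (U n) := by
    intro n
    let _ : MeasurableSpace Ω := 𝓕 i
    have h1 : Measurable fun p : ℕ × Ω => u (a n p.1) p.2 :=
      measurable_from_prod_countable_right fun k =>
        (hu.measurable_le (min_le_left _ _) : Measurable[𝓕 i] (u (a n k)))
    have h2 : Measurable fun p : Set.Iic i × Ω => (⌊((n : ℝ≥0) + 1) * (p.1 : ℝ≥0)⌋₊, p.2) := by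
      refine Measurable.prodMk (Nat.measurable_floor.comp ?_) measurable_snd
      exact (measurable_subtype_coe.comp measurable_fst).const_mul _
    exact (h1.comp h2).stronglyMeasurable
  refine @stronglyMeasurable_of_tendsto (Set.Iic i × Ω) β ℕ
    (Subtype.instMeasurableSpace.prod (𝓕 i)) _ _ atTop _ _ U _ hU ?_
  rw [tendsto_pi_nhds]
  rintro ⟨⟨t, ht⟩, ω⟩
  have hpos : ∀ n : ℕ, (0 : ℝ≥0) < (n : ℝ≥0) + 1 := fun n => by positivity
  have hlow : ∀ n, t ≤ a n ⌊((n : ℝ≥0) + 1) * t⌋₊ := fun n => by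
    refine le_min ht ?_
    rw [le_div_iff₀ (hpos n), mul_comm]
    exact (Nat.lt_floor_add_one _).le
  have hupp : ∀ n, a n ⌊((n : ℝ≥0) + 1) * t⌋₊ ≤ t + 1 / ((n : ℝ≥0) + 1) := fun n => by
    refine (min_le_right _ _).trans ?_
    rw [add_div]
    gcongr
    rw [div_le_iff₀ (hpos n), mul_comm]
    exact Nat.floor_le (by positivity)
  have hlim : Tendsto (fun n : ℕ => t + 1 / ((n : ℝ≥0) + 1)) atTop (𝓝 t) := by
    simpa using (tendsto_const_nhds (x := t)).add
      (tendsto_one_div_add_atTop_nhds_zero_nat (𝕜 := ℝ≥0))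
  have : Tendsto (fun n => a n ⌊((n : ℝ≥0) + 1) * t⌋₊) atTop (𝓝[≥] t) :=
    tendsto_nhdsWithin_iff.2 ⟨tendsto_of_tendsto_of_tendsto_of_le_of_le tendsto_const_nhds hlim
      hlow hupp, Eventually.of_forall hlow⟩
  exact (hc ω t).tendsto.comp this

/-- A right continuous adapted process evaluated at a finite stopping time. -/
theorem measurable_at_stoppingTime {u : ℝ≥0 → Ω → β} (hu : Adapted 𝓕 u)
    (hc : ∀ ω t, ContinuousWithinAt (fun s => u s ω) (Set.Ici t) t) {T : Ω → ℝ≥0}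
    (hT : IsStoppingTime 𝓕 fun ω => (T ω : WithTop ℝ≥0)) :
    Measurable[hT.measurableSpace] fun ω => u (T ω) ω := by
  have := measurable_stoppedValue (isStronglyProgressive_of_rightContinuous hu hc) hT
  have heq : (stoppedValue u fun ω => (T ω : WithTop ℝ≥0)) = fun ω => u (T ω) ω := rfl
  rwa [heq] at this

theorem isStoppingTime_add_const {T : Ω → ℝ≥0}
    (hT : IsStoppingTime 𝓕 fun ω => (T ω : WithTop ℝ≥0)) (s : ℝ≥0) :
    IsStoppingTime 𝓕 fun ω => ((T ω + s : ℝ≥0) : WithTop ℝ≥0) := by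
  intro j
  rcases le_or_gt s j with hs | hs
  · have : {ω | ((T ω + s : ℝ≥0) : WithTop ℝ≥0) ≤ j} = {ω | (T ω : WithTop ℝ≥0) ≤ (j - s : ℝ≥0)} := by
      ext ω
      simp only [Set.mem_ofPred_eq, WithTop.coe_le_coe]
      exact (le_tsub_iff_right hs).symm
    rw [this]
    exact 𝓕.mono tsub_le_self _ (hT (j - s))
  · have : {ω | ((T ω + s : ℝ≥0) : WithTop ℝ≥0) ≤ j} = ∅ := by
      ext ω
      simp only [Set.mem_ofPred_eq, WithTop.coe_le_coe, Set.mem_empty_iff_false, iff_false, not_le]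
      exact hs.trans_le le_add_self
    rw [this]
    exact @MeasurableSet.empty _ (𝓕 j)

end Progressive

/-! ### Strong Markov property and maximal inequality. -/

section Markov

variable {d : ℕ} {E : Set (Rd d)} {Ω : Type*} {mΩ : MeasurableSpace Ω}
  {X : ℝ≥0 → Ω → E} {𝓕 : Filtration ℝ≥0 mΩ} {P : E → Measure Ω} {q : E → Rd d → ℂ}

theorem measurable_norm_coe_sub {f g : Ω → E} (hf : Measurable f) (hg : Measurable g) :
    Measurable fun ω => ‖(f ω : Rd d) - g ω‖ := by
  fun_prop

/-- The transition kernel of a strong Markov process. -/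
noncomputable def transitionKernel (hX : IsStrongMarkovProcess X 𝓕 P) (h : ℝ≥0) : Kernel E E where
  toFun y := (P y).map (X h)
  measurable' := by
    refine Measure.measurable_of_measurable_coe _ fun Γ hΓ => ?_
    have : (fun y => (P y).map (X h) Γ) = fun y => P y {ω | X h ω ∈ Γ} := by
      ext y
      rw [Measure.map_apply hX.adapted.measurable hΓ]
      rfl
    rw [this]
    exact hX.measurable_transition h Γ hΓ

theorem transitionKernel_apply (hX : IsStrongMarkovProcess X 𝓕 P) (h : ℝ≥0) (y : E) {Γ : Set E}
    (hΓ : MeasurableSet Γ) : transitionKernel hX h y Γ = P y {ω | X h ω ∈ Γ} :=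
  Measure.map_apply hX.adapted.measurable hΓ

instance (hX : IsStrongMarkovProcess X 𝓕 P) (h : ℝ≥0) : IsMarkovKernel (transitionKernel hX h) :=
  ⟨fun y => by
    have := hX.isProbabilityMeasure y
    exact Measure.isProbabilityMeasure_map hX.adapted.measurable.aemeasurable⟩

theorem IsLevyTypeProcess.measurable_at (hX : IsLevyTypeProcess X 𝓕 P q) {T : Ω → ℝ≥0}
    (hT : IsStoppingTime 𝓕 fun ω => (T ω : WithTop ℝ≥0)) :
    Measurable[hT.measurableSpace] fun ω => X (T ω) ω :=
  measurable_at_stoppingTime hX.strongMarkov.adapted (fun ω t => (hX.cadlag ω t).1) hT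

/-- The strong Markov property on an event of the past. -/
theorem IsLevyTypeProcess.measure_inter_eq_lintegral (hX : IsLevyTypeProcess X 𝓕 P q) (x : E)
    {T : Ω → ℝ≥0} (hT : IsStoppingTime 𝓕 fun ω => (T ω : WithTop ℝ≥0)) {A : Set Ω}
    (hA : MeasurableSet[hT.measurableSpace] A) (h : ℝ≥0) {Γ : Set E} (hΓ : MeasurableSet Γ) :
    P x (A ∩ {ω | X (T ω + h) ω ∈ Γ}) =
      ∫⁻ ω in A, transitionKernel hX.strongMarkov h (X (T ω) ω) Γ ∂(P x) := by
  have := hX.strongMarkov.isProbabilityMeasure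
  have hle := hT.measurableSpace_le
  have hS := isStoppingTime_add_const hT h
  have hB : MeasurableSet {ω | X (T ω + h) ω ∈ Γ} :=
    hS.measurableSpace_le _ (hX.measurable_at hS hΓ)
  have hsm := hX.strongMarkov.strongMarkov x _ hT (Eventually.of_forall fun ω => WithTop.coe_ne_top)
    h Γ hΓ
  simp only [WithTop.untopD_coe] at hsm
  have h1 := setIntegral_condExp (μ := P x) hle
    (f := {ω | X (T ω + h) ω ∈ Γ}.indicator fun _ => (1 : ℝ))
    ((integrable_const 1).indicator hB) hA
  rw [setIntegral_congr_ae (g := fun ω => (P (X (T ω) ω)).real {ω' | X h ω' ∈ Γ}) (hle _ hA)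
    (hsm.mono fun ω hω _ => hω), setIntegral_indicator hB] at h1
  simp only [integral_const, smul_eq_mul, mul_one, measureReal_restrict_apply_univ] at h1
  have hmeas : Measurable fun ω => transitionKernel hX.strongMarkov h (X (T ω) ω) Γ :=
    (Kernel.measurable_coe _ hΓ).comp ((hX.measurable_at hT).mono hle le_rfl)
  have h2 : ∀ ω, (P (X (T ω) ω)).real {ω' | X h ω' ∈ Γ}
      = (transitionKernel hX.strongMarkov h (X (T ω) ω) Γ).toReal := fun ω => by
    rw [transitionKernel_apply _ _ _ hΓ, Measure.real]
  simp_rw [h2] at h1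
  rw [integral_toReal hmeas.aemeasurable (Eventually.of_forall fun ω => measure_lt_top _ _),
    Measure.real, ENNReal.toReal_eq_toReal_iff' ?_ (measure_ne_top _ _)] at h1
  · exact h1.symm
  · refine ((lintegral_mono (g := fun _ => 1) fun ω => prob_le_one).trans_lt ?_).ne
    simp

/-- Uniform tail bounds on the increments over `[0, h]` hold conditionally on the past of a
finite stopping time. -/
theorem IsLevyTypeProcess.measure_inter_increment_le (hX : IsLevyTypeProcess X 𝓕 P q) (x : E)
    {T : Ω → ℝ≥0} (hT : IsStoppingTime 𝓕 fun ω => (T ω : WithTop ℝ≥0)) {A : Set Ω}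
    (hA : MeasurableSet[hT.measurableSpace] A) (h : ℝ≥0) (r : ℝ) (p : ℝ≥0∞)
    (hp : ∀ y : E, P y {ω | r < ‖(X h ω : Rd d) - y‖} ≤ p) :
    P x (A ∩ {ω | r < ‖(X (T ω + h) ω : Rd d) - X (T ω) ω‖}) ≤ p * P x A := by
  have := hX.strongMarkov.isProbabilityMeasure
  have hle := hT.measurableSpace_le
  have hS := isStoppingTime_add_const hT h
  have hm1 : Measurable fun ω => X (T ω) ω := (hX.measurable_at hT).mono hle le_rfl
  have hm2 : Measurable fun ω => X (T ω + h) ω :=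
    (hX.measurable_at hS).mono hS.measurableSpace_le le_rfl
  have hA' := hle _ hA
  -- The event involves both endpoints, whereas the Markov property fixes a target set for the
  -- second one only. Disintegrating the joint law, checked on rectangles, bridges this.
  have hlaw : ((P x).restrict A).map (fun ω => (X (T ω) ω, X (T ω + h) ω)) =
      (((P x).restrict A).map fun ω => X (T ω) ω) ⊗ₘ transitionKernel hX.strongMarkov h := by
    refine Measure.ext_prod fun {Γ₁ Γ₂} h₁ h₂ => ?_
    rw [Measure.compProd_apply_prod h₁ h₂, Measure.map_apply (hm1.prodMk hm2) (h₁.prod h₂),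
      setLIntegral_map h₁ (Kernel.measurable_coe _ h₂) hm1, Measure.restrict_restrict (hm1 h₁),
      Measure.restrict_apply ((hm1.prodMk hm2) (h₁.prod h₂)), Set.inter_comm _ A,
      Set.inter_comm _ A,
      ← hX.measure_inter_eq_lintegral x hT (hA.inter (hX.measurable_at hT h₁)) h h₂]
    congr 1
    ext ω
    simp only [Set.mem_inter_iff, Set.mem_preimage, Set.mem_prod, Set.mem_ofPred_eq]
    tauto
  have hB : MeasurableSet {z : E × E | r < ‖(z.2 : Rd d) - z.1‖} :=
    measurableSet_lt measurable_const (by fun_prop)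
  have heq : P x (A ∩ {ω | r < ‖(X (T ω + h) ω : Rd d) - X (T ω) ω‖}) =
      ((P x).restrict A).map (fun ω => (X (T ω) ω, X (T ω + h) ω))
        {z : E × E | r < ‖(z.2 : Rd d) - z.1‖} := by
    rw [Measure.map_apply (hm1.prodMk hm2) hB, Measure.restrict_apply ((hm1.prodMk hm2) hB),
      Set.inter_comm]
    rfl
  rw [heq, hlaw, Measure.compProd_apply hB]
  refine (lintegral_mono (g := fun _ => p) fun y => ?_).trans ?_
  · rw [transitionKernel_apply _ _ _ (measurable_prodMk_left hB)]
    exact hp y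
  · rw [lintegral_const, Measure.map_apply hm1 .univ]
    simp

/-- Ottaviani type maximal inequality over a finite set of times. -/
theorem IsLevyTypeProcess.measure_exists_mem_finset_le (hX : IsLevyTypeProcess X 𝓕 P q) (x : E)
    {T : Ω → ℝ≥0} (hT : IsStoppingTime 𝓕 fun ω => (T ω : WithTop ℝ≥0)) (t : ℝ≥0) (r : ℝ)
    (p : ℝ≥0∞) (hp : ∀ y : E, ∀ s ≤ t, P y {ω | r < ‖(X s ω : Rd d) - y‖} ≤ p)
    (D : Finset ℝ≥0) (hD : ∀ s ∈ D, s ≤ t) :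
    P x {ω | ∃ s ∈ D, 2 * r < ‖(X (T ω + s) ω : Rd d) - X (T ω) ω‖} ≤ 2 * p := by
  classical
  have := hX.strongMarkov.isProbabilityMeasure
  let Y : ℝ≥0 → Ω → ℝ := fun s ω => ‖(X (T ω + s) ω : Rd d) - X (T ω) ω‖
  -- First exceedance at `s`: known by time `T + s`, and disjoint for distinct `s`.
  let A : ℝ≥0 → Set Ω := fun s => {ω | 2 * r < Y s ω ∧ ∀ s' ∈ D, s' < s → Y s' ω ≤ 2 * r}
  let G : Set Ω := {ω | r < Y t ω}
  have hY : ∀ s' s, s' ≤ s →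
      Measurable[(isStoppingTime_add_const hT s).measurableSpace] (Y s') := by
    intro s' s hs
    have h0 : Measurable[(isStoppingTime_add_const hT s).measurableSpace] fun ω => X (T ω) ω :=
      (hX.measurable_at hT).mono (hT.measurableSpace_mono _ fun ω =>
        WithTop.coe_le_coe.2 le_self_add) le_rfl
    have h1 : Measurable[(isStoppingTime_add_const hT s).measurableSpace]
        fun ω => X (T ω + s') ω :=
      (hX.measurable_at (isStoppingTime_add_const hT s')).mono
        (IsStoppingTime.measurableSpace_mono _ _ fun ω =>
        WithTop.coe_le_coe.2 (by gcongr)) le_rfl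
    exact measurable_norm_coe_sub h1 h0
  have hA : ∀ s, MeasurableSet[(isStoppingTime_add_const hT s).measurableSpace] (A s) := by
    intro s
    have : A s = {ω | 2 * r < Y s ω} ∩ ⋂ s' ∈ D, ⋂ (_ : s' < s), {ω | Y s' ω ≤ 2 * r} := by
      ext ω; simp [A]
    rw [this]
    refine MeasurableSet.inter (hY s s le_rfl measurableSet_Ioi) ?_
    refine Finset.measurableSet_biInter _ fun s' _ => MeasurableSet.iInter fun hs => ?_
    exact hY s' s hs.le measurableSet_Iic
  have hA' : ∀ s, MeasurableSet (A s) := fun s =>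
    (isStoppingTime_add_const hT s).measurableSpace_le _ (hA s)
  have hdisj : Set.PairwiseDisjoint (D : Set ℝ≥0) A := by
    intro s hs s' hs' hne
    refine Set.disjoint_left.2 fun ω h h' => ?_
    rcases lt_or_gt_of_ne hne with hlt | hlt
    · exact absurd (h'.2 s hs hlt) (not_le.2 h.1)
    · exact absurd (h.2 s' hs' hlt) (not_le.2 h'.1)
  -- A path beyond `2 r` at its first exceedance that ends within `r` at time `t` must move by more
  -- than `r` in between.
  have hsub : {ω | ∃ s ∈ D, 2 * r < Y s ω} ⊆ G ∪ ⋃ s ∈ D, A s ∩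
      {ω | r < ‖(X (T ω + s + (t - s)) ω : Rd d) - X (T ω + s) ω‖} := by
    rintro ω ⟨s₀, hs₀, hω⟩
    by_cases hG : ω ∈ G
    · exact Or.inl hG
    right
    have hne : (D.filter fun s => 2 * r < Y s ω).Nonempty := ⟨s₀, by simp [hs₀, hω]⟩
    obtain ⟨s, hs, hmin⟩ := Finset.exists_min_image _ id hne
    rw [Finset.mem_filter] at hs
    simp only [Set.mem_iUnion]
    refine ⟨s, hs.1, ⟨hs.2, fun s' hs' hlt => ?_⟩, ?_⟩
    · by_contra hcon
      exact absurd (hmin s' (Finset.mem_filter.2 ⟨hs', not_le.1 hcon⟩)) (not_le.2 hlt)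
    · have hst : T ω + s + (t - s) = T ω + t := by
        rw [add_assoc, add_tsub_cancel_of_le (hD s hs.1)]
      rw [Set.mem_ofPred_eq, hst]
      have h1 : Y t ω ≤ r := not_lt.1 hG
      have h2 : 2 * r < Y s ω := hs.2
      have h3 : Y s ω ≤ ‖(X (T ω + t) ω : Rd d) - X (T ω + s) ω‖ + Y t ω := by
        simp only [Y]
        rw [norm_sub_rev (X (T ω + t) ω : Rd d) (X (T ω + s) ω)]
        exact norm_sub_le_norm_sub_add_norm_sub _ _ _
      linarith
  calc P x {ω | ∃ s ∈ D, 2 * r < Y s ω}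
      ≤ P x G + ∑ s ∈ D, P x (A s ∩
        {ω | r < ‖(X (T ω + s + (t - s)) ω : Rd d) - X (T ω + s) ω‖}) :=
        (measure_mono hsub).trans ((measure_union_le _ _).trans
          (by gcongr; exact measure_biUnion_finset_le _ _))
    _ ≤ p + ∑ s ∈ D, p * P x (A s) := by
        gcongr with s hs
        · have := hX.measure_inter_increment_le x hT (A := Set.univ) MeasurableSet.univ t r p
            fun y => hp y t le_rfl
          simpa using this
        · exact hX.measure_inter_increment_le x (isStoppingTime_add_const hT s) (hA s) (t - s) r p
            fun y => hp y _ tsub_le_self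
    _ = p + p * P x (⋃ s ∈ D, A s) := by
        rw [← Finset.mul_sum, measure_biUnion_finset hdisj fun s _ => hA' s]
    _ ≤ p + p * 1 := by gcongr; exact prob_le_one
    _ = 2 * p := by rw [mul_one, two_mul]

end Markov

/-! ### Tail estimates from the symbol. -/

section Tail

variable {d : ℕ} {E : Set (Rd d)} {Ω : Type*} {mΩ : MeasurableSpace Ω}
  {X : ℝ≥0 → Ω → E} {𝓕 : Filtration ℝ≥0 mΩ} {P : E → Measure Ω} {q : E → Rd d → ℂ}

theorem norm_exp_I_mul_ofReal (a : ℝ) : ‖Complex.exp (Complex.I * (a : ℂ))‖ = 1 := by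
  rw [mul_comm]
  exact Complex.norm_exp_ofReal_mul_I a

/-- The martingale has constant expectation, so the difference is the expectation of the
compensating integral, whose integrand is at most `M` in norm. -/
theorem IsLevyTypeProcess.norm_integral_exp_sub_le (hX : IsLevyTypeProcess X 𝓕 P q) (y : E)
    (u : Rd d) (h : ℝ≥0) {M : ℝ} (hM : ∀ z, ‖q z u‖ ≤ M) :
    ‖(∫ ω, Complex.exp (Complex.I * ((inner ℝ u (X h ω : Rd d) : ℝ) : ℂ)) ∂(P y))
      - Complex.exp (Complex.I * ((inner ℝ u (y : Rd d) : ℝ) : ℂ))‖ ≤ h * M := by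
  have := hX.strongMarkov.isProbabilityMeasure y
  have hmart := (hX.hasSymbol y).martingale u
  let e : ℝ≥0 → Ω → ℂ := fun t ω => Complex.exp (Complex.I * ((inner ℝ u (X t ω : Rd d) : ℝ) : ℂ))
  let J : Ω → ℂ := fun ω => ∫ s in (0 : ℝ)..(h : ℝ),
    Complex.exp (Complex.I * ((inner ℝ u (X s.toNNReal ω : Rd d) : ℝ) : ℂ)) * q (X s.toNNReal ω) u
  have he : ∀ t, Integrable (e t) (P y) := fun t => by
    have hm : Measurable (X t) := hX.strongMarkov.adapted.measurable
    refine Integrable.of_bound (C := 1) (Measurable.aestronglyMeasurable ?_)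
      (Eventually.of_forall fun ω => (norm_exp_I_mul_ofReal _).le)
    fun_prop
  -- Integrability of `J` is read off from that of the martingale; no joint measurability in time
  -- and `ω` is needed.
  have hJ : Integrable J (P y) := by
    have : J = fun ω => e h ω - symbolProcess X q u h ω := by
      ext ω
      simp [J, e, symbolProcess]
    rw [this]
    exact (he h).sub (hmart.integrable h)
  have h0 : ∫ ω, symbolProcess X q u 0 ω ∂(P y)
      = Complex.exp (Complex.I * ((inner ℝ u (y : Rd d) : ℝ) : ℂ)) := by
    have : symbolProcess X q u 0 =ᵐ[P y]
        fun _ => Complex.exp (Complex.I * ((inner ℝ u (y : Rd d) : ℝ) : ℂ)) := by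
      filter_upwards [hX.strongMarkov.initial y] with ω hω
      simp [symbolProcess, hω]
    rw [integral_congr_ae this]
    simp
  have hh : ∫ ω, symbolProcess X q u 0 ω ∂(P y) = ∫ ω, symbolProcess X q u h ω ∂(P y) := by
    simpa using hmart.setIntegral_eq (zero_le : 0 ≤ h) MeasurableSet.univ
  have h1 : ∫ ω, symbolProcess X q u h ω ∂(P y) = (∫ ω, e h ω ∂(P y)) - ∫ ω, J ω ∂(P y) :=
    integral_sub (he h) hJ
  rw [← h0, hh, h1, sub_sub_cancel]
  have hJb : ∀ ω, ‖J ω‖ ≤ h * M := fun ω => by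
    have := intervalIntegral.norm_integral_le_of_norm_le_const (a := (0 : ℝ)) (b := h) (C := M)
      (f := fun s : ℝ => Complex.exp (Complex.I *
        ((inner ℝ u (X s.toNNReal ω : Rd d) : ℝ) : ℂ)) * q (X s.toNNReal ω) u)
      fun s _ => by
        rw [norm_mul, norm_exp_I_mul_ofReal, one_mul]
        exact hM _
    simpa [J, mul_comm] using this
  simpa using norm_integral_le_of_norm_le_const (μ := P y) (Eventually.of_forall hJb)

theorem IsLevyTypeProcess.norm_one_sub_charFun_le (hX : IsLevyTypeProcess X 𝓕 P q) (y : E)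
    (u : Rd d) (h : ℝ≥0) {M : ℝ} (hM : ∀ z, ‖q z u‖ ≤ M) :
    ‖1 - charFun ((P y).map fun ω => (X h ω : Rd d) - y) u‖ ≤ h * M := by
  have hm : Measurable (X h) := hX.strongMarkov.adapted.measurable
  let c : ℂ := Complex.exp (Complex.I * ((inner ℝ u (y : Rd d) : ℝ) : ℂ))
  have hc : ‖c‖ = 1 := norm_exp_I_mul_ofReal _
  have hc0 : c ≠ 0 := Complex.exp_ne_zero _
  have hφ : charFun ((P y).map fun ω => (X h ω : Rd d) - y) u = c⁻¹ *
      ∫ ω, Complex.exp (Complex.I * ((inner ℝ u (X h ω : Rd d) : ℝ) : ℂ)) ∂(P y) := by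
    rw [charFun_apply, integral_map (by fun_prop) (Measurable.aestronglyMeasurable (by fun_prop)),
      ← integral_const_mul]
    congr 1
    ext ω
    simp only [c]
    rw [← Complex.exp_neg, ← Complex.exp_add, inner_sub_left, real_inner_comm u,
      real_inner_comm u]
    push_cast
    ring_nf
  have := hX.norm_integral_exp_sub_le y u h hM
  calc ‖1 - charFun ((P y).map fun ω => (X h ω : Rd d) - y) u‖
      = ‖c⁻¹‖ * ‖(∫ ω, Complex.exp (Complex.I * ((inner ℝ u (X h ω : Rd d) : ℝ) : ℂ)) ∂(P y))
        - c‖ := by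
        rw [hφ, ← norm_mul, mul_sub, inv_mul_cancel₀ hc0, norm_sub_rev]
    _ ≤ h * M := by
        rw [norm_inv, hc, inv_one, one_mul]
        exact this

theorem norm_le_of_symbolSup_le {R : ℝ} (hR : 0 < R) {M : ℝ} (hM : 0 ≤ M)
    (h : symbolSup q R ≤ ENNReal.ofReal M) {u : Rd d} (hu : ‖u‖ ≤ R⁻¹) (z : E) : ‖q z u‖ ≤ M := by
  have h1 : ‖q z (R⁻¹ • (R • u))‖ₑ ≤ symbolSup q R := by
    refine le_iSup_of_le z (le_iSup_of_le (R • u) (le_iSup_of_le ?_ le_rfl))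
    rw [norm_smul, Real.norm_of_nonneg hR.le]
    calc R * ‖u‖ ≤ R * R⁻¹ := by gcongr
      _ = 1 := mul_inv_cancel₀ hR.ne'
  rw [smul_smul, inv_mul_cancel₀ hR.ne', one_smul] at h1
  have := h1.trans h
  rwa [← ofReal_norm, ENNReal.ofReal_le_ofReal_iff hM] at this

/-- The truncation inequality averages `1 - charFun` over frequencies of norm at most `2 / r`, the
inverse of `r / 2`. -/
theorem IsLevyTypeProcess.measure_inner_gt_le (hX : IsLevyTypeProcess X 𝓕 P q) (y : E)
    {a : Rd d} (ha : ‖a‖ ≤ 1) (h : ℝ≥0) {r M : ℝ} (hr : 0 < r) (hM : 0 ≤ M)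
    (hq : symbolSup q (r / 2) ≤ ENNReal.ofReal M) :
    P y {ω | r < |inner ℝ a ((X h ω : Rd d) - y)|} ≤ ENNReal.ofReal (2 * h * M) := by
  have := hX.strongMarkov.isProbabilityMeasure y
  have hm : Measurable (X h) := hX.strongMarkov.adapted.measurable
  have hm' : Measurable fun ω => (X h ω : Rd d) - y := by fun_prop
  have := Measure.isProbabilityMeasure_map (μ := P y) hm'.aemeasurable
  have h1 := measureReal_abs_inner_gt_le_integral_charFun
    (μ := (P y).map fun ω => (X h ω : Rd d) - y) (a := a) hr
  have h2 : ‖∫ t in -2 * r⁻¹..2 * r⁻¹,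
      1 - charFun ((P y).map fun ω => (X h ω : Rd d) - y) (t • a)‖
      ≤ h * M * |2 * r⁻¹ - -2 * r⁻¹| := by
    refine intervalIntegral.norm_integral_le_of_norm_le_const fun t ht => ?_
    refine hX.norm_one_sub_charFun_le y _ h fun z => norm_le_of_symbolSup_le (half_pos hr) hM hq ?_ z
    have hr' : 0 < r⁻¹ := inv_pos.2 hr
    rw [Set.uIoc_of_le (by linarith)] at ht
    have ht' : |t| ≤ 2 * r⁻¹ := abs_le.2 ⟨by linarith [ht.1], ht.2⟩
    rw [norm_smul, Real.norm_eq_abs, inv_div]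
    calc |t| * ‖a‖ ≤ (2 * r⁻¹) * 1 := by gcongr
      _ = 2 / r := by rw [mul_one, div_eq_mul_inv]
  have h3 : ((P y).map fun ω => (X h ω : Rd d) - y).real {v | r < |inner ℝ a v|} ≤ 2 * h * M := by
    refine h1.trans ((mul_le_mul_of_nonneg_left h2 (by positivity)).trans (le_of_eq ?_))
    rw [abs_of_pos (by have := inv_pos.2 hr; linarith)]
    field_simp
    ring
  have h4 : P y {ω | r < |inner ℝ a ((X h ω : Rd d) - y)|} =
      ((P y).map fun ω => (X h ω : Rd d) - y) {v | r < |inner ℝ a v|} := by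
    rw [Measure.map_apply hm' (measurableSet_lt measurable_const (by fun_prop))]
    rfl
  rw [h4, ← ofReal_measureReal]
  exact ENNReal.ofReal_le_ofReal h3

/-- The norm is at most the sum of the `d` absolute coordinates; `d + 1` keeps the quotient
meaningful for `d = 0`. -/
theorem exists_lt_abs_coord {v : Rd d} {r : ℝ} (hr : 0 ≤ r) (hv : r < ‖v‖) :
    ∃ i, r / (d + 1) < |inner ℝ (EuclideanSpace.single i (1 : ℝ)) v| := by
  by_contra! hcon
  have h1 : ∀ i, ‖v i‖ ≤ r / (d + 1) := fun i => by
    simpa [EuclideanSpace.inner_single_left] using hcon i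
  have h2 : ‖v‖ ≤ ∑ i, ‖v i‖ := by
    conv_lhs => rw [← (EuclideanSpace.basisFun (Fin d) ℝ).sum_repr v]
    refine (norm_sum_le _ _).trans (le_of_eq ?_)
    simp [norm_smul]
  have h3 : ∑ i, ‖v i‖ ≤ d * (r / (d + 1)) := by
    simpa using Finset.sum_le_card_nsmul Finset.univ (fun i => ‖v i‖) _ fun i _ => h1 i
  have h4 : (d : ℝ) * (r / (d + 1)) ≤ r := by
    rw [mul_div_assoc', div_le_iff₀ (by positivity)]
    nlinarith
  linarith

/-- The tail estimate `P_y(|X_h - y| > r) ≤ 2 d h H(r / (2(d + 1)))`. -/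
theorem IsLevyTypeProcess.measure_norm_sub_gt_le (hX : IsLevyTypeProcess X 𝓕 P q) (y : E)
    (h : ℝ≥0) {r M : ℝ} (hr : 0 < r) (hM : 0 ≤ M)
    (hq : symbolSup q (r / (d + 1) / 2) ≤ ENNReal.ofReal M) :
    P y {ω | r < ‖(X h ω : Rd d) - y‖} ≤ ENNReal.ofReal (2 * d * h * M) := by
  have hsub : {ω | r < ‖(X h ω : Rd d) - y‖} ⊆ ⋃ i : Fin d,
      {ω | r / (d + 1) < |inner ℝ (EuclideanSpace.single i (1 : ℝ)) ((X h ω : Rd d) - y)|} :=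
    fun ω hω => Set.mem_iUnion.2 (exists_lt_abs_coord hr.le hω)
  calc P y {ω | r < ‖(X h ω : Rd d) - y‖}
      ≤ ∑ _i : Fin d, ENNReal.ofReal (2 * h * M) :=
        (measure_mono hsub).trans ((measure_iUnion_fintype_le _ _).trans
          (Finset.sum_le_sum fun i _ => hX.measure_inner_gt_le y (by simp) h (by positivity) hM hq))
    _ = ENNReal.ofReal (2 * d * h * M) := by
        rw [Finset.sum_const, Finset.card_univ, Fintype.card_fin, nsmul_eq_mul,
          ← ENNReal.ofReal_natCast, ← ENNReal.ofReal_mul (by positivity)]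
        congr 1
        ring

end Tail

/-! ### Maximal inequality over whole time intervals. -/

section Maximal

variable {d : ℕ} {E : Set (Rd d)} {Ω : Type*} {mΩ : MeasurableSpace Ω}
  {X : ℝ≥0 → Ω → E} {𝓕 : Filtration ℝ≥0 mΩ} {P : E → Measure Ω} {q : E → Rd d → ℂ}

/-- The event that the process moves further than `2 r` from its position at time `T` at some
time `T + s` with `s ≤ t` in a fixed countable dense set. -/
def largeIncrement (X : ℝ≥0 → Ω → E) (T : Ω → ℝ≥0) (t : ℝ≥0) (r : ℝ) : Set Ω :=
  {ω | ∃ n, TopologicalSpace.denseSeq ℝ≥0 n ≤ t ∧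
    2 * r < ‖(X (T ω + TopologicalSpace.denseSeq ℝ≥0 n) ω : Rd d) - X (T ω) ω‖}

theorem IsLevyTypeProcess.measure_largeIncrement_le (hX : IsLevyTypeProcess X 𝓕 P q) (x : E)
    {T : Ω → ℝ≥0} (hT : IsStoppingTime 𝓕 fun ω => (T ω : WithTop ℝ≥0)) (t : ℝ≥0) {r M : ℝ}
    (hr : 0 < r) (hM : 0 ≤ M) (hq : symbolSup q (r / (d + 1) / 2) ≤ ENNReal.ofReal M) :
    P x (largeIncrement X T t r) ≤ ENNReal.ofReal (4 * d * t * M) := by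
  classical
  let D : ℕ → Finset ℝ≥0 := fun n =>
    ((Finset.range n).image (TopologicalSpace.denseSeq ℝ≥0)).filter (· ≤ t)
  let A : ℕ → Set Ω := fun n => {ω | ∃ s ∈ D n, 2 * r < ‖(X (T ω + s) ω : Rd d) - X (T ω) ω‖}
  have hmono : Monotone A := by
    rintro m n hmn ω ⟨s, hs, hω⟩
    refine ⟨s, ?_, hω⟩
    exact Finset.filter_subset_filter _ (Finset.image_subset_image
      (Finset.range_subset_range.2 hmn)) hs
  have hsub : largeIncrement X T t r ⊆ ⋃ n, A n := by
    rintro ω ⟨n, hn, hω⟩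
    refine Set.mem_iUnion.2 ⟨n + 1, TopologicalSpace.denseSeq ℝ≥0 n, ?_, hω⟩
    simp only [D, Finset.mem_filter, Finset.mem_image, Finset.mem_range]
    exact ⟨⟨n, by omega, rfl⟩, hn⟩
  refine (measure_mono hsub).trans ?_
  rw [hmono.measure_iUnion]
  refine iSup_le fun n => ?_
  refine (hX.measure_exists_mem_finset_le x hT t r (ENNReal.ofReal (2 * d * t * M))
    (fun y s hs => ?_) (D n) fun s hs => (Finset.mem_filter.1 hs).2).trans (le_of_eq ?_)
  · refine (hX.measure_norm_sub_gt_le y s hr hM hq).trans (ENNReal.ofReal_le_ofReal ?_)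
    gcongr
  · rw [← ENNReal.ofReal_ofNat, ← ENNReal.ofReal_mul (by positivity)]
    congr 1
    ring

/-- By right continuity an exceedance at `s` persists just after `s`, where the dense sequence has a
point; `s < t` leaves room for it. -/
theorem norm_sub_le_of_notMem_largeIncrement (hc : IsCadlagProcess X) {T : Ω → ℝ≥0} {t : ℝ≥0}
    {r : ℝ} {ω : Ω} (hω : ω ∉ largeIncrement X T t r) {s : ℝ≥0} (hs : s < t) :
    ‖(X (T ω + s) ω : Rd d) - X (T ω) ω‖ ≤ 2 * r := by
  by_contra! hcon
  have hcont : ContinuousWithinAt (fun s' => ‖(X (T ω + s') ω : Rd d) - X (T ω) ω‖)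
      (Set.Ici s) s := by
    have h1 : ContinuousWithinAt (fun s' => X (T ω + s') ω) (Set.Ici s) s :=
      ContinuousWithinAt.comp (t := Set.Ici (T ω + s)) (g := fun s' => X s' ω)
        (f := fun s' => T ω + s') (hc ω (T ω + s)).1
        (by fun_prop) fun a ha => add_le_add_right (Set.mem_Ici.1 ha) _
    exact ((continuous_subtype_val.continuousAt.comp_continuousWithinAt h1).sub
      continuousWithinAt_const).norm
  have hev := hcont.eventually (lt_mem_nhds hcon)
  rw [eventually_nhdsWithin_iff] at hev
  obtain ⟨u, hu, hu'⟩ := exists_Ico_subset_of_mem_nhds hev ⟨t, hs⟩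
  obtain ⟨n, hn⟩ := (TopologicalSpace.denseRange_denseSeq ℝ≥0).exists_mem_open
    (isOpen_Ioo (a := s) (b := min u t)) (Set.nonempty_Ioo.2 (lt_min hu hs))
  exact hω ⟨n, (hn.2.trans_le (min_le_right _ _)).le,
    hu' ⟨hn.1.le, hn.2.trans_le (min_le_left _ _)⟩ hn.1.le⟩

theorem measurableSet_largeIncrement (hX : IsLevyTypeProcess X 𝓕 P q)
    {T : Ω → ℝ≥0} (hT : IsStoppingTime 𝓕 fun ω => (T ω : WithTop ℝ≥0)) (t : ℝ≥0) (r : ℝ) :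
    MeasurableSet (largeIncrement X T t r) := by
  have hm : ∀ s, Measurable fun ω => X (T ω + s) ω := fun s =>
    (hX.measurable_at (isStoppingTime_add_const hT s)).mono (IsStoppingTime.measurableSpace_le _)
      le_rfl
  have hm0 : Measurable fun ω => X (T ω) ω := by simpa using hm 0
  have : largeIncrement X T t r = ⋃ n, ⋃ (_ : TopologicalSpace.denseSeq ℝ≥0 n ≤ t),
      {ω | 2 * r < ‖(X (T ω + TopologicalSpace.denseSeq ℝ≥0 n) ω : Rd d) - X (T ω) ω‖} := by
    ext ω
    simp [largeIncrement]
  rw [this]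
  exact MeasurableSet.iUnion fun n => MeasurableSet.iUnion fun _ =>
    measurable_norm_coe_sub (hm _) hm0 measurableSet_Ioi

end Maximal

/-! ### Summability and dyadic scales. -/

section Rate

variable {d : ℕ} {E : Set (Rd d)} {Ω : Type*} {mΩ : MeasurableSpace Ω}
  {X : ℝ≥0 → Ω → E} {𝓕 : Filtration ℝ≥0 mΩ} {P : E → Measure Ω} {q : E → Rd d → ℂ}

theorem exists_symbolSup_le_rpow {lam : ℝ} (hlam : uniformIndex q < ENNReal.ofReal lam) :
    ∃ l : ℝ, 0 < l ∧ l < lam ∧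
      ∀ᶠ R in 𝓝[>] (0 : ℝ), symbolSup q R ≤ ENNReal.ofReal (R ^ (-l)) := by
  simp only [uniformIndex, iInf_lt_iff] at hlam
  obtain ⟨l, hl, hlim, hlt⟩ := hlam
  refine ⟨l, hl, ((ENNReal.ofReal_lt_ofReal_iff_of_nonneg hl.le).1 hlt), ?_⟩
  have hev : ∀ᶠ R in 𝓝[>] (0 : ℝ), ENNReal.ofReal (R ^ l) * symbolSup q R < 1 :=
    eventually_lt_of_limsup_lt (hlim.trans_lt one_pos)
  filter_upwards [hev, self_mem_nhdsWithin] with R hR hR0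
  have hpos : 0 < R ^ l := Real.rpow_pos_of_pos hR0 l
  rw [Real.rpow_neg (le_of_lt hR0), ENNReal.ofReal_inv_of_pos hpos, ENNReal.le_inv_iff_mul_le,
    mul_comm]
  exact hR.le

theorem IsLevyTypeProcess.tsum_measure_largeIncrement_ne_top (hX : IsLevyTypeProcess X 𝓕 P q)
    (x : E) {l b : ℝ} (hb : 0 < b) (hbl : b * l < 1)
    (hq : ∀ᶠ R in 𝓝[>] (0 : ℝ), symbolSup q R ≤ ENNReal.ofReal (R ^ (-l)))
    {T : Ω → ℝ≥0} (hT : IsStoppingTime 𝓕 fun ω => (T ω : WithTop ℝ≥0)) :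
    ∑' m : ℕ, P x (largeIncrement X T (2 * (1 / 2) ^ m) (((1 / 2 : ℝ) ^ m) ^ b)) ≠ ∞ := by
  have := hX.strongMarkov.isProbabilityMeasure x
  set A : ℕ → Set Ω := fun m => largeIncrement X T (2 * (1 / 2) ^ m) (((1 / 2 : ℝ) ^ m) ^ b)
  have hlim : Tendsto (fun m : ℕ => ((1 / 2 : ℝ) ^ m) ^ b / (d + 1) / 2) atTop (𝓝[>] 0) := by
    refine tendsto_nhdsWithin_iff.2 ⟨?_, Eventually.of_forall fun m => ?_⟩
    · have h1 : Tendsto (fun m : ℕ => (1 / 2 : ℝ) ^ m) atTop (𝓝 0) :=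
        tendsto_pow_atTop_nhds_zero_of_lt_one (by norm_num) (by norm_num)
      have h2 := h1.rpow_const (p := b) (Or.inr hb.le)
      rw [Real.zero_rpow hb.ne'] at h2
      simpa using (h2.div_const ((d : ℝ) + 1)).div_const 2
    · exact Set.mem_Ioi.2 (by positivity)
  -- This is `4 d t M` with `t = 2 · 2^{-m}` and `M = (2^{-mb} / (2(d + 1))) ^ (-l)`, the powers of
  -- `2^{-m}` being collected in `ρ ^ m`.
  let C : ℝ := 8 * d * (((d : ℝ) + 1) * 2) ^ l
  let ρ : ℝ := (1 / 2 : ℝ) ^ (1 - b * l)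
  have hρ : ρ < 1 := Real.rpow_lt_one (by norm_num) (by norm_num) (by linarith)
  have hρ0 : 0 ≤ ρ := by positivity
  have hbound : ∀ᶠ m in atTop, ‖(P x).real (A m)‖ ≤ C * ρ ^ m := by
    filter_upwards [hlim.eventually hq] with m hm
    rw [Real.norm_of_nonneg measureReal_nonneg]
    refine ENNReal.toReal_le_of_le_ofReal (by positivity) ?_
    refine (hX.measure_largeIncrement_le x hT _ (by positivity) (by positivity) hm).trans
      (le_of_eq ?_)
    congr 1
    have hz : (0 : ℝ) < (1 / 2) ^ m := by positivity
    have hρm : ρ ^ m = (1 / 2) ^ m * ((1 / 2) ^ m) ^ (b * -l) := by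
      rw [Real.rpow_pow_comm (by norm_num), sub_eq_add_neg, ← mul_neg, Real.rpow_add hz,
        Real.rpow_one]
    rw [hρm, div_div, Real.div_rpow (by positivity) (by positivity),
      Real.rpow_neg (x := _ * _) (by positivity), ← Real.rpow_mul hz.le, div_inv_eq_mul]
    push_cast
    ring
  have hsum : Summable fun m => (P x).real (A m) :=
    Summable.of_norm_bounded_eventually_nat ((summable_geometric_of_lt_one hρ0 hρ).mul_left C)
      hbound
  have : ∑' m, P x (A m) = ENNReal.ofReal (∑' m, (P x).real (A m)) := by
    rw [ENNReal.ofReal_tsum_of_nonneg (fun m => measureReal_nonneg) hsum]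
    exact tsum_congr fun m => (ofReal_measureReal).symm
  rw [this]
  exact ENNReal.ofReal_ne_top

/-- Passage from bounds at dyadic scales with exponent `b` to a bound at all small times with a
smaller exponent `a`. -/
theorem exists_forall_le_mul_rpow {a b ε : ℝ} (hab : a < b) (hb : 0 < b) (hε : 0 < ε) :
    ∃ δ : ℝ, 0 < δ ∧ ∀ (m : ℕ) (t : ℝ), (1 / 2) ^ (m + 1) < t → t ≤ δ →
      2 * ((1 / 2 : ℝ) ^ m) ^ b ≤ ε * t ^ a := by
  -- The factor `2 ^ b` pays for `2^{-m} < 2 t`; `δ` then solves `C δ ^ (b - a) = ε`.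
  let C : ℝ := 2 * 2 ^ b
  refine ⟨(ε / C) ^ (b - a)⁻¹, by positivity, fun m t hmt ht => ?_⟩
  have ht0 : 0 < t := lt_trans (by positivity) hmt
  have h1 : ((1 / 2 : ℝ) ^ m) ^ b ≤ 2 ^ b * t ^ b := by
    rw [← Real.mul_rpow (by norm_num) ht0.le]
    refine Real.rpow_le_rpow (by positivity) ?_ hb.le
    rw [pow_succ] at hmt
    linarith
  have h2 : t ^ (b - a) ≤ ε / C := by
    calc t ^ (b - a) ≤ ((ε / C) ^ (b - a)⁻¹) ^ (b - a) :=
          Real.rpow_le_rpow ht0.le ht (by linarith)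
      _ = ε / C := by
          rw [← Real.rpow_mul (by positivity), inv_mul_cancel₀ (by linarith), Real.rpow_one]
  calc 2 * ((1 / 2 : ℝ) ^ m) ^ b ≤ 2 * (2 ^ b * t ^ b) := by gcongr
    _ = C * t ^ (b - a) * t ^ a := by
        rw [mul_assoc, ← Real.rpow_add ht0, sub_add_cancel]
        ring
    _ ≤ C * (ε / C) * t ^ a := by gcongr
    _ = ε * t ^ a := by rw [mul_div_cancel₀ _ (by positivity)]

end Rate

end LevyType

/-! ### Borel–Cantelli and the choice of `δ`. -/

theorem propositionp {d : ℕ} {E : Set (LevyType.Rd d)} {Ω : Type*} {mΩ : MeasurableSpace Ω}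
    (X : ℝ≥0 → Ω → E) (𝓕 : Filtration ℝ≥0 mΩ) (P : E → Measure Ω)
    (q : E → LevyType.Rd d → ℂ) (hX : LevyType.IsLevyTypeProcess X 𝓕 P q)
    (lam : ℝ) (hlam : LevyType.uniformIndex q < ENNReal.ofReal lam)
    (τ : Ω → WithTop ℝ≥0) (hτ : IsStoppingTime 𝓕 τ) (x : E) :
    ∃ N : Set Ω, P x N = 0 ∧
      ∀ ε : ℝ, 0 < ε → ∃ δ : Ω → ℝ, Measurable δ ∧ (∀ ω, 0 < δ ω) ∧
        ∀ ω, ω ∉ N → ∀ T : ℝ≥0, τ ω = (T : WithTop ℝ≥0) →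
          ∀ t : ℝ≥0, (t : ℝ) ≤ δ ω →
            ‖(X (T + t) ω : LevyType.Rd d) - (X T ω : LevyType.Rd d)‖
              ≤ ε * (t : ℝ) ^ (1 / lam) := by
  classical
  obtain ⟨l, hl, hllam, hq⟩ := LevyType.exists_symbolSup_le_rpow hlam
  obtain ⟨b, hab, hbl⟩ := exists_between (one_div_lt_one_div_of_lt hl hllam)
  have hb : 0 < b := (one_div_pos.2 (hl.trans hllam)).trans hab
  have hbl' : b * l < 1 := (lt_div_iff₀ hl).1 hbl
  -- Truncation makes the stopping time finite, so the default `0` is never used.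
  let T : ℕ → Ω → ℝ≥0 := fun k ω => (min (τ ω) (k : ℝ≥0)).untopD 0
  have hTmin : ∀ k ω, (T k ω : WithTop ℝ≥0) = min (τ ω) (k : ℝ≥0) := fun k ω => by
    have : min (τ ω) ((k : ℝ≥0) : WithTop ℝ≥0) ≠ ⊤ :=
      ((min_le_right _ _).trans_lt (WithTop.coe_lt_top _)).ne
    lift min (τ ω) ((k : ℝ≥0) : WithTop ℝ≥0) to ℝ≥0 using this with s hs
    simp only [T, ← hs, WithTop.untopD_coe]
  have hT : ∀ k, IsStoppingTime 𝓕 fun ω => (T k ω : WithTop ℝ≥0) := fun k => by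
    simp_rw [hTmin]
    exact hτ.min_const _
  let A : ℕ → ℕ → Set Ω := fun k m =>
    LevyType.largeIncrement X (T k) (2 * (1 / 2) ^ m) (((1 / 2 : ℝ) ^ m) ^ b)
  have hA : ∀ k m, MeasurableSet (A k m) := fun k m =>
    LevyType.measurableSet_largeIncrement hX (hT k) _ _
  -- From scale `n` on no large increment occurs, for some `k` with `T k = τ`.
  let G : ℕ → Set Ω := fun n =>
    {ω | τ ω = ⊤ ∨ ∃ k : ℕ, τ ω ≤ (k : ℝ≥0) ∧ ∀ m, n ≤ m → ω ∉ A k m}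
  have hG : ∀ n, MeasurableSet (G n) := fun n => by
    have : G n = {ω | τ ω = ⊤} ∪ ⋃ k : ℕ, {ω | τ ω ≤ (k : ℝ≥0)} ∩ ⋂ m, ⋂ (_ : n ≤ m), (A k m)ᶜ := by
      ext ω
      simp [G]
    rw [this]
    refine MeasurableSet.union hτ.measurableSet_eq_top (MeasurableSet.iUnion fun k => ?_)
    exact (𝓕.le _ _ (hτ _)).inter
      (MeasurableSet.iInter fun m => MeasurableSet.iInter fun _ => (hA k m).compl)
  refine ⟨(⋃ n, G n)ᶜ, ?_, fun ε hε => ?_⟩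
  · refine measure_mono_null (t := ⋃ k, {ω | ∃ᶠ m in atTop, ω ∈ A k m}) (fun ω hω => ?_)
      (measure_iUnion_null fun k => measure_setOfPred_frequently_eq_zero
        (hX.tsum_measure_largeIncrement_ne_top x hb hbl' hq (hT k)))
    by_contra hcon
    simp only [Set.mem_iUnion, Set.mem_ofPred_eq, not_exists, not_frequently] at hcon
    refine hω ?_
    rw [Set.mem_iUnion]
    by_cases htop : τ ω = ⊤
    · exact ⟨0, Or.inl htop⟩
    · lift τ ω to ℝ≥0 using htop with S hS
      obtain ⟨k, hk⟩ := exists_nat_ge S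
      obtain ⟨n, hn⟩ := eventually_atTop.1 (hcon k)
      exact ⟨n, Or.inr ⟨k, hS ▸ WithTop.coe_le_coe.2 hk, hn⟩⟩
  · obtain ⟨δ₀, hδ₀, hδ⟩ := LevyType.exists_forall_le_mul_rpow hab hb hε
    -- Adding the exceptional set makes the search for the first good `n` total, hence `n₀`
    -- measurable.
    have hp : ∀ ω, ∃ n, ω ∈ G n ∪ (⋃ n, G n)ᶜ := fun ω => by
      by_cases h : ω ∈ ⋃ n, G n
      · obtain ⟨n, hn⟩ := Set.mem_iUnion.1 h
        exact ⟨n, Or.inl hn⟩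
      · exact ⟨0, Or.inr h⟩
    let n₀ : Ω → ℕ := fun ω => Nat.find (hp ω)
    have hn₀ : Measurable n₀ :=
      measurable_find hp fun n => (hG n).union (MeasurableSet.iUnion hG).compl
    refine ⟨fun ω => min δ₀ ((1 / 2) ^ n₀ ω), ?_, fun ω => by positivity, ?_⟩
    · exact (measurable_from_nat (f := fun n : ℕ => min δ₀ ((1 / 2 : ℝ) ^ n))).comp hn₀
    intro ω hω S hS t ht
    rcases eq_or_ne t 0 with rfl | ht0
    · simp only [add_zero, sub_self, norm_zero]
      positivity
    have ht0' : (0 : ℝ) < t := by positivity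
    have hmem : ω ∈ G (n₀ ω) := (Nat.find_spec (hp ω)).resolve_right hω
    obtain ⟨k, hk, hm⟩ := hmem.resolve_left (by rw [hS]; exact WithTop.coe_ne_top)
    have hTS : T k ω = S := by
      have := hTmin k ω
      rw [min_eq_left hk, hS] at this
      exact WithTop.coe_injective this
    have ht1 : (t : ℝ) ≤ (1 / 2) ^ n₀ ω := ht.trans (min_le_right _ _)
    obtain ⟨m, hm1, hm2⟩ := exists_nat_pow_near_of_lt_one ht0'
      (ht1.trans (pow_le_one₀ (by norm_num) (by norm_num))) (by norm_num : (0 : ℝ) < 1 / 2)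
      (by norm_num)
    have hnm : n₀ ω ≤ m := by
      have := (pow_lt_pow_iff_right_of_lt_one₀ (by norm_num : (0 : ℝ) < 1 / 2)
        (by norm_num)).1 (hm1.trans_le ht1)
      omega
    -- The factor 2 in the time window makes this strict even when `t = (1 / 2) ^ m`.
    have hlt : t < 2 * (1 / 2) ^ m := by
      rw [← NNReal.coe_lt_coe]
      push_cast
      have : (0 : ℝ) < (1 / 2) ^ m := by positivity
      linarith
    have := LevyType.norm_sub_le_of_notMem_largeIncrement hX.cadlag (hm m hnm) hlt
    rw [hTS] at this
    exact this.trans (hδ m t hm1 (ht.trans (min_le_left _ _)))
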